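/- Let $0<p<1$. For each $N\ge 0$ let $A\subseteq\{0,\dots,N\}$ be a random subset containing each $n\in\{0,\dots,N\}$ independently with probability $p$, and let $Y=Y_N=|\{0\le n\le N:\ n\notin A+A\}|$, where $A+A=\{a+b:\ a,b\in A\}$. For $k\ge 0$ let $a_k$ be the probability that a random string of $k$ independent bits, each equal to $1$ with probability $p$, has no two consecutive entries equal to $1$ (so $a_0=a_1=1$). Then the series below converges, $\lim_{N\to\infty}\mathbb{E}[Y^2]$ exists, and $$\lim_{N\to\infty}\mathbb{E}[Y^2]=-\left(\frac{2}{p^2}-\frac1p-1\right)+2\sum_{l=1}^{\infty}\frac{a_{2l}+(1-p)a_{l-1}+(1-p)a_l a_{2l}+(1-p)^2a_l a_{l-1}}{(1-a_{2l+2})(1-a_{2l})}.$$ -/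

import Mathlib

open scoped Pointwise

noncomputable section

namespace RandomSumset

/-- The law of a random subset `A ⊆ {0, …, N}` that contains each `n ∈ {0, …, N}` independently
with probability `p`. -/
def subsetLaw (N : ℕ) (p : unitInterval) : MeasureTheory.Measure (Set ℕ) :=
  ProbabilityTheory.setBernoulli (Set.Iic N) p

/-- `Y`: the number of integers `0 ≤ n ≤ N` that are missing from the sumset `A + A`. -/
def missingSummands (N : ℕ) (A : Set ℕ) : ℕ :=
  {n : ℕ | n ≤ N ∧ n ∉ A + A}.ncard

/-- The chain `(1, …, k)` is satisfied by `A`: of any two consecutive entries, at least one lies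
outside `A`. -/
def ChainSatisfied (k : ℕ) (A : Set ℕ) : Prop :=
  ∀ i : ℕ, 1 ≤ i → i + 1 ≤ k → i ∉ A ∨ i + 1 ∉ A

/-- `a_k`: the probability that the chain `(1, …, k)` is satisfied, when each of `1, …, k` is
included independently with probability `p`. The empty chain gives `a_0 = 1`. -/
def chainProb (p : unitInterval) (k : ℕ) : ℝ :=
  (ProbabilityTheory.setBernoulli (Set.Icc 1 k) p).real {A : Set ℕ | ChainSatisfied k A}

/-- The `l`-th term (`l ≥ 1`) of the series for the limiting second moment. -/
def secondMomentTerm (p : unitInterval) (l : ℕ) : ℝ :=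
  (chainProb p (2 * l) + (1 - (p : ℝ)) * chainProb p (l - 1)
      + (1 - (p : ℝ)) * chainProb p l * chainProb p (2 * l)
      + (1 - (p : ℝ)) ^ 2 * chainProb p l * chainProb p (l - 1))
    / ((1 - chainProb p (2 * l + 2)) * (1 - chainProb p (2 * l)))

end RandomSumset

end

/-!
Expanding the square, `E[Y²]` is the sum over `m, n ≤ N` of the probability that neither `m` nor `n`
lies in `A + A`. This is the probability that `A` is an independent set in the graph, possibly with
loops, in which `x` and `y` are joined when `x + y ∈ {m, n}`. For `m ≤ n` only the vertices
`0, …, n` matter, so the probability does not depend on `N`, and the limit of `E[Y²]` is an infinite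
sum over pairs.

Let `m < n`, `d = n - m` and `n + 1 = q d + r` with `0 ≤ r < d`. The composition of the reflections
`x ↦ n - x` and `x ↦ m - x` is the translation by `d`, so the graph respects residue classes modulo
`d`: the `r` classes with `q + 1` elements are exchanged by a reflection, and so are the other
`d - r` classes, which have `q` elements (`indepWeight_sum_eq`). Two distinct classes exchanged with
one another, of `k` elements each, span a path with `2 k` vertices, of probability `a_{2k}`
(`blockWeight_add_two`). A class fixed by the reflection spans a path with `k` vertices and a loop at
its end; the end has to be avoided, which leaves `(1 - p) a_{k-1}` (`blockWeight_one`). Hence the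
probability is `F(q + 1, r) F(q, d - r)` with
`F(k, t) = a_{2k} ^ ⌊t / 2⌋ ((1 - p) a_{k-1}) ^ (t mod 2)`.

Summing geometric series, `G(k) = ∑_{t ≥ 0} F(k, t) = (1 + (1 - p) a_{k-1}) / (1 - a_{2k})`
(`hasSum_blockWeight`). Division with remainder turns the sum over the pairs `(n, d)` with
`1 ≤ d ≤ n + 1` into a sum over `q ≥ 1`, `r ≥ 0` and `s = d - r ≥ 1`, which is
`∑_{q ≥ 1} G(q + 1) (G(q) - 1)` (`hasSum_sum_jointMissing`), and the `q`-th summand is the `q`-th term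
of the series in question. The pairs with `d = n + 1` have no `m`; they stand for the diagonal
`m = n`, which occurs once and not twice in `E[Y²]`. This gives the correction
`-(G(1) - 1) = -(2 / p² - 1 / p - 1)` (`hasSum_jointMissing_succ`). The series converges because
`a_k` decays geometrically, by `a_{k+2} ≤ (1 - p²) a_k`.
-/

namespace RandomSumset

open Finset MeasureTheory ProbabilityTheory

/-! ### Weight of independent sets -/

section IndepWeight

open scoped Classical in
/-- The probability that a random subset `A` of the finite set `S`, containing each element
independently with probability `p`, spans no pair related by `R`. A pair may be degenerate: an
element related to itself must be avoided by `A`. -/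
noncomputable def indepWeight {α : Type*} (p : ℝ) (R : α → α → Prop) (S : Finset α) : ℝ :=
  ∑ A ∈ S.powerset,
    if ∀ x ∈ A, ∀ y ∈ A, ¬ R x y then p ^ #A * (1 - p) ^ (#S - #A) else 0

variable {α β : Type*} {p : ℝ} {R R' : α → α → Prop} {S T : Finset α}

lemma indepWeight_nonneg (h0 : 0 ≤ p) (h1 : p ≤ 1) : 0 ≤ indepWeight p R S := by
  refine sum_nonneg fun A _ => ?_
  have : 0 ≤ 1 - p := by linarith
  split_ifs <;> positivity

lemma indepWeight_mono (h0 : 0 ≤ p) (h1 : p ≤ 1) (h : ∀ x ∈ S, ∀ y ∈ S, R' x y → R x y) :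
    indepWeight p R S ≤ indepWeight p R' S := by
  refine sum_le_sum fun A hA => ?_
  have : 0 ≤ 1 - p := by linarith
  have hA := mem_powerset.1 hA
  split_ifs with h2 h3
  · exact le_rfl
  · exact absurd (fun x hx y hy hR => h2 x hx y hy (h x (hA hx) y (hA hy) hR)) h3
  · positivity
  · exact le_rfl

open scoped Classical in
lemma indepWeight_congr (h : ∀ x ∈ S, ∀ y ∈ S, R x y ↔ R' x y) :
    indepWeight p R S = indepWeight p R' S := by
  refine sum_congr rfl fun A hA => ?_
  have hA := mem_powerset.1 hA
  refine if_congr ?_ rfl rfl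
  exact forall₂_congr fun x hx => forall₂_congr fun y hy => not_congr (h x (hA hx) y (hA hy))

open scoped Classical in
lemma indepWeight_of_forall_not (h : ∀ x ∈ S, ∀ y ∈ S, ¬ R x y) : indepWeight p R S = 1 := by
  have : indepWeight p R S = ∑ A ∈ S.powerset, p ^ #A * (1 - p) ^ (#S - #A) := by
    refine sum_congr rfl fun A hA => if_pos ?_
    have hA := mem_powerset.1 hA
    exact fun x hx y hy => h x (hA hx) y (hA hy)
  rw [this, sum_pow_mul_eq_add_pow]
  simp

lemma indepWeight_le_one (h0 : 0 ≤ p) (h1 : p ≤ 1) : indepWeight p R S ≤ 1 :=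
  (indepWeight_mono h0 h1 (R' := fun _ _ => False) (by simp)).trans_eq
    (indepWeight_of_forall_not (by simp))

/-- Parts of the vertex set without relations between them contribute independent factors. -/
lemma indepWeight_union [DecidableEq α] (hST : Disjoint S T)
    (h : ∀ x ∈ S, ∀ y ∈ T, ¬ R x y ∧ ¬ R y x) :
    indepWeight p R (S ∪ T) = indepWeight p R S * indepWeight p R T := by
  rw [indepWeight, indepWeight, indepWeight, sum_mul_sum, ← sum_product']
  symm
  refine sum_bij' (fun x _ => x.1 ∪ x.2) (fun C _ => (C ∩ S, C ∩ T)) ?_ ?_ ?_ ?_ ?_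
  · rintro ⟨A, B⟩ hx
    simp only [mem_product, mem_powerset] at hx ⊢
    exact union_subset_union hx.1 hx.2
  · intro C _
    simp
  · rintro ⟨A, B⟩ hx
    simp only [mem_product, mem_powerset] at hx
    have h1 : Disjoint B S := (hST.mono_right hx.2).symm
    have h2 : Disjoint A T := hST.mono_left hx.1
    ext x
    · simp only [mem_inter, mem_union]
      exact ⟨fun ⟨h, h'⟩ => h.resolve_right fun hb => (disjoint_left.1 h1 hb h'),
        fun h => ⟨Or.inl h, hx.1 h⟩⟩
    · simp only [mem_inter, mem_union]
      exact ⟨fun ⟨h, h'⟩ => h.resolve_left fun hb => (disjoint_left.1 h2 hb h'),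
        fun h => ⟨Or.inr h, hx.2 h⟩⟩
  · intro C hC
    rw [mem_powerset] at hC
    simp only [← inter_union_distrib_left]
    exact inter_eq_left.2 hC
  · rintro ⟨A, B⟩ hx
    simp only [mem_product, mem_powerset] at hx
    have hAB : Disjoint A B := hST.mono hx.1 hx.2
    have hiff : (∀ x ∈ A ∪ B, ∀ y ∈ A ∪ B, ¬ R x y) ↔
        (∀ x ∈ A, ∀ y ∈ A, ¬ R x y) ∧ (∀ x ∈ B, ∀ y ∈ B, ¬ R x y) := by
      constructor
      · exact fun H => ⟨fun x hx y hy => H x (mem_union_left _ hx) y (mem_union_left _ hy),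
          fun x hx y hy => H x (mem_union_right _ hx) y (mem_union_right _ hy)⟩
      · rintro ⟨H1, H2⟩ x hx' y hy'
        rcases mem_union.1 hx' with hx' | hx' <;> rcases mem_union.1 hy' with hy' | hy'
        · exact H1 x hx' y hy'
        · exact (h x (hx.1 hx') y (hx.2 hy')).1
        · exact (h y (hx.1 hy') x (hx.2 hx')).2
        · exact H2 x hx' y hy'
    simp only [card_union_of_disjoint hST, card_union_of_disjoint hAB]
    have e1 := card_le_card hx.1
    have e2 := card_le_card hx.2
    have e : #S + #T - (#A + #B) = (#S - #A) + (#T - #B) := by omega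
    by_cases c1 : ∀ x ∈ A, ∀ y ∈ A, ¬ R x y <;> by_cases c2 : ∀ x ∈ B, ∀ y ∈ B, ¬ R x y
    · rw [if_pos c1, if_pos c2, if_pos (hiff.2 ⟨c1, c2⟩), e]
      ring
    · rw [if_neg c2, if_neg fun H => c2 (hiff.1 H).2, mul_zero]
    · rw [if_neg c1, if_neg fun H => c1 (hiff.1 H).1, zero_mul]
    · rw [if_neg c1, if_neg fun H => c1 (hiff.1 H).1, zero_mul]

open scoped Classical in
lemma indepWeight_image [DecidableEq α] {f : β → α} {U : Finset β} (hf : Set.InjOn f U) :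
    indepWeight p R (U.image f) = indepWeight p (fun x y => R (f x) (f y)) U := by
  rw [indepWeight, indepWeight]
  symm
  have hinj : ∀ A ∈ U.powerset, #(A.image f) = #A := fun A hA =>
    card_image_of_injOn (hf.mono (by simpa using hA))
  refine sum_bij (fun A _ => A.image f) ?_ ?_ ?_ ?_
  · intro A hA
    exact mem_powerset.2 (image_subset_image (mem_powerset.1 hA))
  · intro A hA B hB hAB
    have := (hf.image_eq_image_iff (s₁ := (A : Set β)) (s₂ := B) (by simpa using hA)
      (by simpa using hB)).1 (by simpa using congrArg (fun s : Finset α => (s : Set α)) hAB)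
    exact_mod_cast this
  · intro B hB
    obtain ⟨A, hA, rfl⟩ := subset_image_iff.1 (mem_powerset.1 hB)
    exact ⟨A, mem_powerset.2 (by exact_mod_cast hA), rfl⟩
  · intro A hA
    rw [hinj A hA, hinj U (by simp)]
    refine if_congr ?_ rfl rfl
    simp only [forall_mem_image]

open scoped Classical in
/-- An element related to itself has to be avoided. -/
lemma indepWeight_insert_of_self [DecidableEq α] {v : α} (hv : v ∉ S) (h : R v v) :
    indepWeight p R (insert v S) = (1 - p) * indepWeight p R S := by
  rw [indepWeight, sum_powerset_insert hv, indepWeight, mul_sum]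
  rw [sum_eq_zero (s := S.powerset) (f := fun A => if ∀ x ∈ insert v A, ∀ y ∈ insert v A, ¬ R x y
    then p ^ #(insert v A) * (1 - p) ^ (#(insert v S) - #(insert v A)) else 0), add_zero]
  · refine sum_congr rfl fun A hA => ?_
    have e := card_le_card (mem_powerset.1 hA)
    rw [card_insert_of_notMem hv, show #S + 1 - #A = (#S - #A) + 1 by omega]
    split_ifs <;> ring
  · intro A _
    rw [if_neg]
    exact fun H => H v (mem_insert_self _ _) v (mem_insert_self _ _) h

end IndepWeight

/-! ### Paths and blocks of residue classes -/

section Blocks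

/-- The weight of a path with `k` vertices, in which only consecutive vertices are related. -/
noncomputable def pathWeight (p : ℝ) (k : ℕ) : ℝ :=
  indepWeight p (fun a b => a + 1 = b ∨ b + 1 = a) (range k)

/-- The relation on pairs `(j, i)` that describes a block of `t` residue classes with `k` elements
each: the residues `j` are exchanged by the reflection of `{0, …, t - 1}`, and the quotients `i`
have to sum to `k - 1` or to `k - 2`. -/
def BlockRel (k t : ℕ) (x y : ℕ × ℕ) : Prop :=
  x.1 + y.1 + 1 = t ∧ (x.2 + y.2 + 1 = k ∨ x.2 + y.2 + 2 = k)

/-- The weight of a block of `t` residue classes with `k` elements each. -/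
noncomputable def blockWeight (p : ℝ) (k t : ℕ) : ℝ :=
  indepWeight p (BlockRel k t) (range t ×ˢ range k)

variable {p : ℝ}

lemma pathWeight_nonneg (h0 : 0 ≤ p) (h1 : p ≤ 1) (k : ℕ) : 0 ≤ pathWeight p k :=
  indepWeight_nonneg h0 h1

lemma pathWeight_le_one (h0 : 0 ≤ p) (h1 : p ≤ 1) (k : ℕ) : pathWeight p k ≤ 1 :=
  indepWeight_le_one h0 h1

lemma pathWeight_zero : pathWeight p 0 = 1 := indepWeight_of_forall_not (by simp)

lemma pathWeight_two : pathWeight p 2 = 1 - p ^ 2 := by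
  have h : (range 2).powerset = {∅, {0}, {1}, {0, 1}} := by decide
  rw [pathWeight, indepWeight, h]
  rw [sum_insert (by decide), sum_insert (by decide), sum_insert (by decide), sum_singleton]
  simp
  ring

/-- Cutting an edge of a path can only increase its weight. -/
lemma pathWeight_add_le (h0 : 0 ≤ p) (h1 : p ≤ 1) (j k : ℕ) :
    pathWeight p (j + k) ≤ pathWeight p j * pathWeight p k := by
  have hS : range (j + k) = range j ∪ (range k).image (j + ·) := by
    ext x
    simp only [mem_union, mem_range, mem_image]
    constructor
    · intro hx
      by_cases h : x < j
      · exact Or.inl h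
      · exact Or.inr ⟨x - j, by omega, by omega⟩
    · rintro (h | ⟨y, hy, rfl⟩) <;> omega
  have hdisj : Disjoint (range j) ((range k).image (j + ·)) := by
    rw [disjoint_left]
    simp only [mem_range, mem_image, not_exists, not_and]
    intro a ha b hb
    omega
  calc pathWeight p (j + k)
      ≤ indepWeight p (fun a b => (a + 1 = b ∨ b + 1 = a) ∧ (a < j ↔ b < j)) (range (j + k)) :=
        indepWeight_mono h0 h1 fun x _ y _ h => h.1
    _ = _ := by
      rw [hS, indepWeight_union hdisj, indepWeight_image (by intro a _ b _; simp)]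
      · congr 1 <;> refine indepWeight_congr fun x hx y hy => ?_
        · simp only [mem_range] at hx hy
          omega
        · omega
      · simp only [mem_range, mem_image]
        rintro x hx _ ⟨y, hy, rfl⟩
        omega

lemma blockWeight_zero (k : ℕ) : blockWeight p k 0 = 1 :=
  indepWeight_of_forall_not (by simp)

/-- The middle residue class of a block is the path `k - 1, 0, k - 2, 1, …`, whose last vertex is
related to itself. -/
lemma blockWeight_one (k : ℕ) : blockWeight p (k + 1) 1 = (1 - p) * pathWeight p k := by
  let f : ℕ → ℕ × ℕ := fun a => (0, if a % 2 = 0 then k - a / 2 else a / 2)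
  have hf : Set.InjOn f (range (k + 1)) := by
    intro a ha b hb h
    simp only [coe_range, Set.mem_Iio] at ha hb
    simp only [f, Prod.mk.injEq, true_and] at h
    split_ifs at h <;> omega
  have himg : range 1 ×ˢ range (k + 1) = (range (k + 1)).image f := by
    symm
    refine eq_of_subset_of_card_le ?_ ?_
    · intro x hx
      obtain ⟨a, ha, rfl⟩ := mem_image.1 hx
      simp only [mem_range] at ha
      simp only [f, mem_product, mem_range]
      split_ifs <;> omega
    · rw [card_image_of_injOn hf]
      simp
  rw [blockWeight, himg, indepWeight_image hf, pathWeight, range_add_one,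
    ← indepWeight_congr (S := range k)
      (R := fun x y => BlockRel (k + 1) 1 (f x) (f y))
      (R' := fun a b => a + 1 = b ∨ b + 1 = a)]
  · refine indepWeight_insert_of_self (by simp) ?_
    simp only [BlockRel, f, true_and]
    split_ifs <;> omega
  · intro a ha b hb
    simp only [mem_range] at ha hb
    simp only [BlockRel, f, true_and]
    split_ifs <;> omega

/-- The outermost two residue classes of a block form a path with `2 * k` vertices. -/
lemma blockWeight_add_two (k t : ℕ) :
    blockWeight p k (t + 2) = pathWeight p (2 * k) * blockWeight p k t := by
  -- The path is `(t + 1, k - 1), (0, 0), (t + 1, k - 2), (0, 1), …`; `g` shifts the inner block.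
  let f : ℕ → ℕ × ℕ := fun a => if a % 2 = 0 then (t + 1, k - 1 - a / 2) else (0, a / 2)
  let g : ℕ × ℕ → ℕ × ℕ := fun x => (x.1 + 1, x.2)
  have hf : Set.InjOn f (range (2 * k)) := by
    intro a ha b hb h
    simp only [coe_range, Set.mem_Iio] at ha hb
    simp only [f] at h
    split_ifs at h <;> simp only [Prod.mk.injEq] at h <;> omega
  have hg : Set.InjOn g (range t ×ˢ range k : Finset (ℕ × ℕ)) := by
    rintro ⟨a, b⟩ _ ⟨c, d⟩ _ h
    simpa [g] using h
  have hmemf : ∀ x, x ∈ (range (2 * k)).image f → (x.1 = 0 ∨ x.1 = t + 1) ∧ x.2 < k := by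
    intro x hx
    obtain ⟨a, ha, rfl⟩ := mem_image.1 hx
    simp only [mem_range] at ha
    simp only [f]
    split_ifs <;> simp <;> omega
  have hmemg : ∀ x, x ∈ (range t ×ˢ range k).image g → 1 ≤ x.1 ∧ x.1 ≤ t ∧ x.2 < k := by
    intro x hx
    obtain ⟨a, ha, rfl⟩ := mem_image.1 hx
    simp only [mem_product, mem_range] at ha
    simp only [g]
    omega
  have hdisj : Disjoint ((range (2 * k)).image f) ((range t ×ˢ range k).image g) := by
    rw [disjoint_left]
    intro x hx hy
    have h1 := hmemf x hx
    have h2 := hmemg x hy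
    omega
  have himg : range (t + 2) ×ˢ range k =
      (range (2 * k)).image f ∪ (range t ×ˢ range k).image g := by
    symm
    refine eq_of_subset_of_card_le ?_ ?_
    · intro x hx
      simp only [mem_product, mem_range]
      rcases mem_union.1 hx with hx | hx
      · have := hmemf x hx
        omega
      · have := hmemg x hx
        omega
    · rw [card_union_of_disjoint hdisj, card_image_of_injOn hf, card_image_of_injOn hg]
      simp only [card_product, card_range]
      exact le_of_eq (by ring)
  rw [blockWeight, himg, indepWeight_union hdisj, indepWeight_image hf, indepWeight_image hg]
  · congr 1 <;> refine indepWeight_congr ?_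
    · intro a ha b hb
      simp only [mem_range] at ha hb
      simp only [BlockRel, f]
      split_ifs <;> simp only [true_and] <;> omega
    · intro x hx y hy
      simp only [BlockRel, g]
      omega
  · intro x hx y hy
    have h1 := hmemf x hx
    have h2 := hmemg y hy
    simp only [BlockRel]
    omega

/-- If `n + 1 = q d + r` with `r < d`, the relation `x + y ∈ {n - d, n}` splits `{0, …, n}` into
the block of the residues below `r`, with `q + 1` elements each, and the block of the remaining
`s = d - r` residues, with `q` elements each. -/
lemma indepWeight_sum_eq (q r s : ℕ) (hs : 1 ≤ s) :
    indepWeight p (fun x y => x + y + 1 = q * (r + s) + r ∨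
      x + y + 1 + (r + s) = q * (r + s) + r) (range (q * (r + s) + r)) =
      blockWeight p (q + 1) r * blockWeight p q s := by
  have hd : 0 < r + s := by omega
  let f : ℕ × ℕ → ℕ := fun x => x.1 + (r + s) * x.2
  let g : ℕ × ℕ → ℕ := fun x => r + x.1 + (r + s) * x.2
  -- Uniqueness of quotient and remainder modulo `r + s`.
  have key : ∀ a b i j, a < r + s → b < r + s → a + (r + s) * i = b + (r + s) * j →
      a = b ∧ i = j := by
    intro a b i j ha hb h
    have h1 := congrArg (· % (r + s)) h
    have h2 := congrArg (· / (r + s)) h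
    simp only [Nat.add_mul_mod_self_left, Nat.mod_eq_of_lt ha, Nat.mod_eq_of_lt hb] at h1
    simp only [Nat.add_mul_div_left _ _ hd, Nat.div_eq_of_lt ha, Nat.div_eq_of_lt hb] at h2
    exact ⟨h1, by omega⟩
  have hf : Set.InjOn f (range r ×ˢ range (q + 1) : Finset (ℕ × ℕ)) := by
    rintro ⟨a, i⟩ hx ⟨b, j⟩ hy h
    simp only [coe_product, coe_range, Set.mem_prod, Set.mem_Iio] at hx hy
    obtain ⟨rfl, rfl⟩ := key a b i j (by omega) (by omega) h
    rfl
  have hg : Set.InjOn g (range s ×ˢ range q : Finset (ℕ × ℕ)) := by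
    rintro ⟨a, i⟩ hx ⟨b, j⟩ hy h
    simp only [coe_product, coe_range, Set.mem_prod, Set.mem_Iio] at hx hy
    obtain ⟨h1, rfl⟩ := key (r + a) (r + b) i j (by omega) (by omega) h
    obtain rfl : a = b := by omega
    rfl
  have hdisj : Disjoint ((range r ×ˢ range (q + 1)).image f) ((range s ×ˢ range q).image g) := by
    rw [disjoint_left]
    intro x hx hy
    obtain ⟨⟨a, i⟩, ha, rfl⟩ := mem_image.1 hx
    obtain ⟨⟨b, j⟩, hb, h⟩ := mem_image.1 hy
    simp only [mem_product, mem_range] at ha hb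
    have := (key (r + b) a j i (by omega) (by omega) h).1
    omega
  have himg : range (q * (r + s) + r) =
      (range r ×ˢ range (q + 1)).image f ∪ (range s ×ˢ range q).image g := by
    symm
    refine eq_of_subset_of_card_le ?_ ?_
    · intro x hx
      rw [mem_range]
      rcases mem_union.1 hx with hx | hx
      · obtain ⟨⟨a, i⟩, ha, rfl⟩ := mem_image.1 hx
        simp only [mem_product, mem_range] at ha
        have : (r + s) * i ≤ (r + s) * q := Nat.mul_le_mul_left _ (by omega)
        simp only [f]
        linarith
      · obtain ⟨⟨a, i⟩, ha, rfl⟩ := mem_image.1 hx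
        simp only [mem_product, mem_range] at ha
        have : (r + s) * (i + 1) ≤ (r + s) * q := Nat.mul_le_mul_left _ (by omega)
        simp only [g]
        linarith
    · rw [card_union_of_disjoint hdisj, card_image_of_injOn hf, card_image_of_injOn hg]
      simp only [card_product, card_range]
      exact le_of_eq (by ring)
  -- Adding two remainders produces at most one carry.
  have carry : ∀ a i b j, a < 2 * (r + s) → b < r + s → a + (r + s) * i = b + (r + s) * j →
      (a = b ∧ i = j) ∨ (a = b + (r + s) ∧ i + 1 = j) := by
    intro a i b j ha hb h
    by_cases h' : a < r + s
    · exact Or.inl (key a b i j h' hb h)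
    · have := key (a - (r + s)) b (i + 1) j (by omega) hb (by rw [mul_add, mul_one]; omega)
      right
      omega
  rw [himg, indepWeight_union hdisj, indepWeight_image hf, indepWeight_image hg]
  · congr 1 <;> refine indepWeight_congr ?_
    · rintro ⟨a, i⟩ hx ⟨b, j⟩ hy
      simp only [mem_product, mem_range] at hx hy
      simp only [BlockRel, f]
      have e1 : a + (r + s) * i + (b + (r + s) * j) + 1 =
        (a + b + 1) + (r + s) * (i + j) := by ring
      have e2 : (a + b + 1) + (r + s) * (i + j) + (r + s) =
        (a + b + 1) + (r + s) * (i + j + 1) := by ring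
      have e3 : q * (r + s) + r = r + (r + s) * q := by ring
      rw [e1, e2, e3]
      constructor
      · rintro (h | h)
        · have := carry _ _ _ _ (by omega) (by omega) h
          omega
        · have := carry _ _ _ _ (by omega) (by omega) h
          omega
      · rintro ⟨h, h' | h'⟩
        · left
          rw [h, show i + j = q by omega]
        · right
          rw [h, show i + j + 1 = q by omega]
    · rintro ⟨a, i⟩ hx ⟨b, j⟩ hy
      simp only [mem_product, mem_range] at hx hy
      simp only [BlockRel, g]
      have e1 : r + a + (r + s) * i + (r + b + (r + s) * j) + 1 =
        (r + (r + a + b + 1)) + (r + s) * (i + j) := by ring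
      have e2 : (r + (r + a + b + 1)) + (r + s) * (i + j) + (r + s) =
        (r + (r + a + b + 1)) + (r + s) * (i + j + 1) := by ring
      have e3 : q * (r + s) + r = r + (r + s) * q := by ring
      have e4 : ∀ m, (r + (r + s)) + (r + s) * m = r + (r + s) * (m + 1) := fun m => by ring
      rw [e1, e2, e3]
      constructor
      · rintro (h | h) <;> rw [add_assoc r, add_right_inj] at h
        · have := carry (r + a + b + 1) (i + j) 0 q (by omega) (by omega) (by omega)
          omega
        · have := carry (r + a + b + 1) (i + j + 1) 0 q (by omega) (by omega) (by omega)
          omega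
      · rintro ⟨h, h' | h'⟩
        · left
          rw [show r + a + b + 1 = r + s by omega, e4, h']
        · right
          rw [show r + a + b + 1 = r + s by omega, e4, show i + j + 1 + 1 = q by omega]
  · intro x hx y hy
    obtain ⟨⟨a, i⟩, ha, rfl⟩ := mem_image.1 hx
    obtain ⟨⟨b, j⟩, hb, rfl⟩ := mem_image.1 hy
    simp only [mem_product, mem_range] at ha hb
    have e3 : q * (r + s) + r = r + (r + s) * q := by ring
    have e1 : f (a, i) + g (b, j) + 1 = r + ((a + b + 1) + (r + s) * (i + j)) := by
      simp only [f, g]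
      ring
    have e2 : (a + b + 1) + (r + s) * (i + j) + (r + s) =
      (a + b + 1) + (r + s) * (i + j + 1) := by ring
    have H : ¬ (f (a, i) + g (b, j) + 1 = q * (r + s) + r ∨
        f (a, i) + g (b, j) + 1 + (r + s) = q * (r + s) + r) := by
      rw [e1, e3, add_assoc r, e2]
      rintro (h | h) <;> rw [add_right_inj] at h
      · have := key (a + b + 1) 0 (i + j) q (by omega) hd (by omega)
        omega
      · have := key (a + b + 1) 0 (i + j + 1) q (by omega) hd (by omega)
        omega
    exact ⟨H, by rwa [add_comm (g (b, j))]⟩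

end Blocks

/-! ### Finite random sets and the second moment -/

section Moments

variable {ι : Type*} [Countable ι]

lemma setBernoulli_restrict_powerset (S : Finset ι) (p : unitInterval) :
    (setBernoulli (S : Set ι) p).restrict
      (S.powerset.map coeEmb.toEmbedding : Finset (Set ι)) =
      setBernoulli (S : Set ι) p := by
  refine Measure.restrict_eq_self_of_ae_mem ?_
  filter_upwards [setBernoulli_ae_subset] with A hA
  obtain ⟨B, rfl⟩ := (S.finite_toSet.subset hA).exists_finset_coe
  simpa using hA

lemma integrable_setBernoulli (S : Finset ι) (p : unitInterval) (f : Set ι → ℝ) :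
    Integrable f (setBernoulli (S : Set ι) p) := by
  rw [← setBernoulli_restrict_powerset]
  exact IntegrableOn.finset

lemma integral_setBernoulli (S : Finset ι) (p : unitInterval) (f : Set ι → ℝ) :
    ∫ A, f A ∂(setBernoulli (S : Set ι) p) =
      ∑ A ∈ S.powerset, (p : ℝ) ^ #A * (1 - p) ^ (#S - #A) * f A := by
  classical
  rw [← setBernoulli_restrict_powerset,
    setIntegral_finset (S.powerset.map coeEmb.toEmbedding) IntegrableOn.finset, sum_map]
  refine sum_congr rfl fun A hA => ?_
  have hA := mem_powerset.1 hA
  simp only [RelEmbedding.coe_toEmbedding, coe_coeEmb]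
  rw [setBernoulli_real_singleton p (by exact_mod_cast hA) S.finite_toSet, ← coe_sdiff,
    Set.ncard_coe_finset, Set.ncard_coe_finset, card_sdiff_of_subset hA, smul_eq_mul]

open scoped Classical in
lemma setBernoulli_real_eq (S : Finset ι) (p : unitInterval) (E : Set (Set ι)) :
    (setBernoulli (S : Set ι) p).real E =
      ∑ A ∈ S.powerset, if (A : Set ι) ∈ E then (p : ℝ) ^ #A * (1 - p) ^ (#S - #A) else 0 := by
  have hfin : {A ∈ E | A ⊆ (S : Set ι)}.Finite := S.finite_toSet.finite_subsets.subset fun A h => h.2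
  rw [measureReal_def, setBernoulli_apply_eq_apply_subsets, ← measureReal_def,
    ← integral_indicator_one hfin.measurableSet, integral_setBernoulli]
  refine sum_congr rfl fun A hA => ?_
  have hA : (A : Set ι) ⊆ S := by exact_mod_cast mem_powerset.1 hA
  by_cases h : (A : Set ι) ∈ E
  · have h' : (A : Set ι) ∈ {A ∈ E | A ⊆ (S : Set ι)} := ⟨h, hA⟩
    rw [if_pos h, Set.indicator_of_mem h', Pi.one_apply, mul_one]
  · have h' : (A : Set ι) ∉ {A ∈ E | A ⊆ (S : Set ι)} := fun h' => h h'.1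
    rw [if_neg h, Set.indicator_of_notMem h', mul_zero]

/-- The chain probabilities are path weights. -/
lemma chainProb_eq_pathWeight (p : unitInterval) (k : ℕ) : chainProb p k = pathWeight p k := by
  classical
  have himg : Icc 1 k = (range k).image (· + 1) := by
    ext x
    simp only [mem_Icc, mem_image, mem_range]
    exact ⟨fun h => ⟨x - 1, by omega, by omega⟩, by rintro ⟨y, hy, rfl⟩; omega⟩
  have h1 : pathWeight p k = indepWeight p (fun a b => a + 1 = b ∨ b + 1 = a) (Icc 1 k) := by
    rw [himg, indepWeight_image (by intro a _ b _; simp)]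
    exact indepWeight_congr fun a _ b _ => by omega
  rw [h1, chainProb, ← coe_Icc, setBernoulli_real_eq, indepWeight]
  refine sum_congr rfl fun A hA => ?_
  have hA : ∀ x ∈ A, 1 ≤ x ∧ x ≤ k := fun x hx => mem_Icc.1 (mem_powerset.1 hA hx)
  have hiff : (A : Set ℕ) ∈ {A : Set ℕ | ChainSatisfied k A} ↔
      ∀ x ∈ A, ∀ y ∈ A, ¬ (x + 1 = y ∨ y + 1 = x) := by
    simp only [Set.mem_ofPred_eq, ChainSatisfied, mem_coe]
    constructor
    · rintro h x hx y hy (rfl | rfl)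
      · exact (h x (hA _ hx).1 (hA _ hy).2).elim (· hx) (· hy)
      · exact (h y (hA _ hy).1 (hA _ hx).2).elim (· hy) (· hx)
    · intro h i _ _
      by_contra! hc
      exact h i hc.1 (i + 1) hc.2 (Or.inl rfl)
  split_ifs <;> first | rfl | tauto

/-- The probability that neither `n` nor `n - d` is a sum of two elements of the random subset of
`{0, …, n}`; for `d = n + 1` the second condition is void. -/
noncomputable def jointMissing (p : ℝ) (n d : ℕ) : ℝ :=
  indepWeight p (fun x y => x + y = n ∨ x + y + d = n) (range (n + 1))

/-- Here `n + 1 = (q + 1) * d + r` with `d = r + s + 1`, so `r` residue classes modulo `d` have `q + 2`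
elements in `{0, …, n}` and the other `s + 1` have `q + 1`. -/
lemma jointMissing_eq (p : ℝ) (q r s : ℕ) :
    jointMissing p ((q + 1) * (r + s + 1) + r - 1) (r + s + 1) =
      blockWeight p (q + 2) r * blockWeight p (q + 1) (s + 1) := by
  have h := indepWeight_sum_eq (p := p) (q + 1) r (s + 1) (by omega)
  have hpos : 1 ≤ (q + 1) * (r + (s + 1)) := Nat.mul_pos (by omega) (by omega)
  rw [← h, jointMissing, add_assoc r s 1, Nat.sub_add_cancel (by omega)]
  refine indepWeight_congr fun x _ y _ => ?_
  omega

/-- The vertices above `n` and `m` are irrelevant for the events `n ∉ A + A` and `m ∉ A + A`. -/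
lemma indepWeight_range_eq (p : ℝ) {m n N : ℕ} (hm : m ≤ n) (hn : n ≤ N) :
    indepWeight p (fun x y => x + y = n ∨ x + y = m) (range (N + 1)) =
      indepWeight p (fun x y => x + y = n ∨ x + y = m) (range (n + 1)) := by
  have hS : range (N + 1) = range (n + 1) ∪ Ico (n + 1) (N + 1) := by
    ext x
    simp only [mem_union, mem_range, mem_Ico]
    omega
  rw [hS, indepWeight_union,
    indepWeight_of_forall_not (S := Ico (n + 1) (N + 1)), mul_one]
  · intro x hx y hy
    simp only [mem_Ico] at hx hy
    omega
  · rw [disjoint_left]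
    intro x hx hy
    simp only [mem_range, mem_Ico] at hx hy
    omega
  · intro x hx y hy
    simp only [mem_range, mem_Ico] at hx hy
    omega

lemma integrable_missingSummands_sq (p : unitInterval) (N : ℕ) :
    Integrable (fun A : Set ℕ => (missingSummands N A : ℝ) ^ 2) (subsetLaw N p) := by
  rw [subsetLaw, ← coe_Iic]
  exact integrable_setBernoulli _ _ _

lemma sum_sum_range_symm (w : ℕ → ℕ → ℝ) (hw : ∀ m n, w m n = w n m) (N : ℕ) :
    ∑ n ∈ range N, ∑ m ∈ range N, w n m =
      ∑ n ∈ range N, (2 * (∑ m ∈ range n, w n m) + w n n) := by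
  induction N with
  | zero => simp
  | succ N ih =>
    simp only [sum_range_succ, sum_add_distrib] at ih ⊢
    rw [ih, sum_congr rfl fun m _ => hw m N]
    ring

/-- The second moment as a sum over pairs `(n, d)` with `1 ≤ d ≤ n + 1`. -/
lemma integral_missingSummands_sq (p : unitInterval) (N : ℕ) :
    ∫ A, (missingSummands N A : ℝ) ^ 2 ∂(subsetLaw N p) =
      ∑ n ∈ range (N + 1),
        (2 * (∑ i ∈ range (n + 1), jointMissing p n (i + 1)) - jointMissing p n (n + 1)) := by
  classical
  have hY : ∀ A : Set ℕ, (missingSummands N A : ℝ) =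
      ∑ n ∈ range (N + 1), if n ∉ A + A then 1 else 0 := by
    intro A
    rw [sum_boole, missingSummands, ← Set.ncard_coe_finset]
    congr 2
    ext n
    simp
  have hpair : ∀ n m, ∑ A ∈ (Iic N).powerset, (p : ℝ) ^ #A * (1 - p) ^ (#(Iic N) - #A) *
      ((if n ∉ (A : Set ℕ) + A then 1 else 0) * (if m ∉ (A : Set ℕ) + A then 1 else 0)) =
      indepWeight p (fun x y => x + y = n ∨ x + y = m) (range (N + 1)) := by
    intro n m
    have : Iic N = range (N + 1) := by
      ext x
      simp
    rw [indepWeight, this]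
    refine sum_congr rfl fun A _ => ?_
    have hiff : (∀ x ∈ A, ∀ y ∈ A, ¬ (x + y = n ∨ x + y = m)) ↔
        n ∉ (A : Set ℕ) + A ∧ m ∉ (A : Set ℕ) + A := by
      simp only [Set.mem_add, mem_coe, not_exists, not_and, not_or]
      exact ⟨fun h => ⟨fun x hx y hy => (h x hx y hy).1, fun x hx y hy => (h x hx y hy).2⟩,
        fun h x hx y hy => ⟨h.1 x hx y hy, h.2 x hx y hy⟩⟩
    simp only [mul_one, mul_ite, mul_zero]
    split_ifs <;> first | rfl | tauto
  rw [subsetLaw, ← coe_Iic, integral_setBernoulli]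
  simp only [hY, sq, sum_mul_sum]
  simp only [mul_sum]
  rw [sum_comm]
  simp only [sum_comm (s := (Iic N).powerset)]
  simp only [hpair]
  rw [sum_sum_range_symm _ fun m n => by simp only [or_comm]]
  refine sum_congr rfl fun n hn => ?_
  have hn : n ≤ N := Nat.lt_succ_iff.1 (mem_range.1 hn)
  have e1 : indepWeight p (fun x y => x + y = n ∨ x + y = n) (range (N + 1)) =
      jointMissing p n (n + 1) := by
    rw [indepWeight_range_eq _ le_rfl hn]
    exact indepWeight_congr fun x _ y _ => by omega
  have e2 : ∑ m ∈ range n, indepWeight p (fun x y => x + y = n ∨ x + y = m) (range (N + 1)) =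
      ∑ i ∈ range n, jointMissing p n (i + 1) := by
    rw [← sum_range_reflect]
    refine sum_congr rfl fun i hi => ?_
    have hi := mem_range.1 hi
    rw [indepWeight_range_eq _ (by omega) hn]
    exact indepWeight_congr fun x _ y _ => by omega
  rw [e1, e2, ← mul_sum, sum_range_succ]
  ring

end Moments

/-! ### Summation over all pairs -/

section Summation

variable {p : ℝ}

lemma blockWeight_nonneg (h0 : 0 ≤ p) (h1 : p ≤ 1) (k t : ℕ) : 0 ≤ blockWeight p k t :=
  indepWeight_nonneg h0 h1

lemma blockWeight_two_mul (k u : ℕ) : blockWeight p k (2 * u) = pathWeight p (2 * k) ^ u := by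
  induction u with
  | zero => simp [blockWeight_zero]
  | succ u ih => rw [mul_add, mul_one, blockWeight_add_two, ih, pow_succ']

lemma blockWeight_two_mul_add_one (k u : ℕ) :
    blockWeight p (k + 1) (2 * u + 1) =
      pathWeight p (2 * (k + 1)) ^ u * ((1 - p) * pathWeight p k) := by
  induction u with
  | zero => simp [blockWeight_one]
  | succ u ih =>
    rw [show 2 * (u + 1) + 1 = (2 * u + 1) + 2 by ring, blockWeight_add_two, ih, pow_succ']
    ring

lemma pathWeight_add_two_le (h0 : 0 ≤ p) (h1 : p ≤ 1) (k : ℕ) :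
    pathWeight p (k + 2) ≤ pathWeight p k * (1 - p ^ 2) :=
  (pathWeight_add_le h0 h1 k 2).trans_eq (by rw [pathWeight_two])

lemma pathWeight_two_mul_succ_le (h0 : 0 ≤ p) (h1 : p ≤ 1) (k : ℕ) :
    pathWeight p (2 * (k + 1)) ≤ 1 - p ^ 2 := by
  have h := pathWeight_add_two_le h0 h1 (2 * k)
  have : (0 : ℝ) ≤ 1 - p ^ 2 := by nlinarith
  exact h.trans (mul_le_of_le_one_left this (pathWeight_le_one h0 h1 _))

lemma summable_pathWeight (h0 : 0 < p) (h1 : p ≤ 1) : Summable (pathWeight p) := by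
  have hc0 : (0 : ℝ) ≤ 1 - p ^ 2 := by nlinarith
  have hc1 : 1 - p ^ 2 < 1 := by nlinarith
  have key : ∀ e k, pathWeight p (2 * k + e) ≤ (1 - p ^ 2) ^ k := by
    intro e k
    induction k with
    | zero => simpa using pathWeight_le_one h0.le h1 _
    | succ k ih =>
      rw [show 2 * (k + 1) + e = (2 * k + e) + 2 by ring, pow_succ]
      exact (pathWeight_add_two_le h0.le h1 _).trans (mul_le_mul_of_nonneg_right ih hc0)
  have hs := summable_geometric_of_lt_one hc0 hc1
  exact Summable.even_add_odd
    (hs.of_nonneg_of_le (fun k => pathWeight_nonneg h0.le h1 _) (fun k => key 0 k))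
    (hs.of_nonneg_of_le (fun k => pathWeight_nonneg h0.le h1 _) (fun k => key 1 k))

/-- The sum over `t` of the weights of the blocks of `t` residue classes with `k` elements each,
in closed form; it is meaningful for `k ≥ 1`. -/
noncomputable def blockSum (p : ℝ) (k : ℕ) : ℝ :=
  (1 + (1 - p) * pathWeight p (k - 1)) / (1 - pathWeight p (2 * k))

/-- Even and odd `t` give two geometric series of ratio `a_{2 (k + 1)}`, the second one carrying the
factor of the middle residue class. -/
lemma hasSum_blockWeight (h0 : 0 < p) (h1 : p ≤ 1) (k : ℕ) :
    HasSum (blockWeight p (k + 1)) (blockSum p (k + 1)) := by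
  have ha0 := pathWeight_nonneg h0.le h1 (2 * (k + 1))
  have ha1 : pathWeight p (2 * (k + 1)) < 1 :=
    (pathWeight_two_mul_succ_le h0.le h1 k).trans_lt (by nlinarith)
  have hg := hasSum_geometric_of_lt_one ha0 ha1
  have he : HasSum (fun u => blockWeight p (k + 1) (2 * u))
      (1 - pathWeight p (2 * (k + 1)))⁻¹ := by
    simpa only [blockWeight_two_mul] using hg
  have ho : HasSum (fun u => blockWeight p (k + 1) (2 * u + 1))
      ((1 - pathWeight p (2 * (k + 1)))⁻¹ * ((1 - p) * pathWeight p k)) := by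
    simpa only [blockWeight_two_mul_add_one] using hg.mul_right _
  have := he.even_add_odd ho
  rwa [show blockSum p (k + 1) = (1 - pathWeight p (2 * (k + 1)))⁻¹ +
    (1 - pathWeight p (2 * (k + 1)))⁻¹ * ((1 - p) * pathWeight p k) by
      rw [blockSum, Nat.add_sub_cancel, div_eq_mul_inv]; ring]

/-- The void block `t = 0` contributes `1` to the sum. -/
lemma hasSum_blockWeight_succ (h0 : 0 < p) (h1 : p ≤ 1) (k : ℕ) :
    HasSum (fun t => blockWeight p (k + 1) (t + 1)) (blockSum p (k + 1) - 1) := by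
  simpa [blockWeight_zero] using (hasSum_nat_add_iff' 1).2 (hasSum_blockWeight h0 h1 k)

lemma secondMomentTerm_eq (p : unitInterval) (hp0 : 0 < p) (k : ℕ) :
    secondMomentTerm p (k + 1) = blockSum p (k + 2) * (blockSum p (k + 1) - 1) := by
  have h0 : (0 : ℝ) < p := hp0
  have h1 : (p : ℝ) ≤ 1 := p.2.2
  have hlt : ∀ j, 1 - pathWeight p (2 * (j + 1)) ≠ 0 := fun j =>
    (sub_pos.2 ((pathWeight_two_mul_succ_le h0.le h1 j).trans_lt (by nlinarith))).ne'
  have e1 := hlt k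
  have e2 := hlt (k + 1)
  simp only [secondMomentTerm, chainProb_eq_pathWeight, blockSum]
  rw [show k + 1 - 1 = k by omega, show k + 2 - 1 = k + 1 by omega,
    show 2 * (k + 1) + 2 = 2 * (k + 1 + 1) by ring, show 2 * (k + 2) = 2 * (k + 1 + 1) by ring]
  field_simp
  ring

lemma blockSum_one_sub_one (h0 : p ≠ 0) : blockSum p 1 - 1 = 2 / p ^ 2 - 1 / p - 1 := by
  have : pathWeight p (1 - 1) = 1 := pathWeight_zero
  rw [blockSum, this, mul_one, pathWeight_two]
  field_simp
  ring

lemma summable_secondMomentTerm (p : unitInterval) (hp0 : 0 < p) :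
    Summable fun l : ℕ => secondMomentTerm p (l + 1) := by
  have h0 : (0 : ℝ) < p := hp0
  have h1 : (p : ℝ) ≤ 1 := p.2.2
  have hq : (0 : ℝ) ≤ 1 - p := by linarith
  have hc : (0 : ℝ) < p ^ 2 := by positivity
  have hden : ∀ j, (p : ℝ) ^ 2 ≤ 1 - pathWeight p (2 * (j + 1)) := fun j => by
    linarith [pathWeight_two_mul_succ_le h0.le h1 j]
  have hP := pathWeight_nonneg h0.le h1
  have hP1 := pathWeight_le_one h0.le h1
  have hnum : ∀ k, pathWeight p (2 * (k + 1)) + (1 - p) * pathWeight p k ≤ 2 * pathWeight p k := by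
    intro k
    have e1 : pathWeight p (2 * (k + 1)) ≤ pathWeight p k := by
      rw [show 2 * (k + 1) = k + (k + 2) by ring]
      exact (pathWeight_add_le h0.le h1 _ _).trans (mul_le_of_le_one_right (hP _) (hP1 _))
    have e2 : (1 - (p : ℝ)) * pathWeight p k ≤ pathWeight p k :=
      mul_le_of_le_one_left (hP _) (by linarith)
    linarith
  have heq : ∀ k, blockSum p (k + 1) - 1 =
      (pathWeight p (2 * (k + 1)) + (1 - p) * pathWeight p k) /
        (1 - pathWeight p (2 * (k + 1))) := by
    intro k
    have := (hc.trans_le (hden k)).ne'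
    rw [blockSum, Nat.add_sub_cancel]
    field_simp
    ring
  have hnn : ∀ k, 0 ≤ blockSum p (k + 1) - 1 := fun k => by
    rw [heq]
    exact div_nonneg (add_nonneg (hP _) (mul_nonneg hq (hP _))) (hc.le.trans (hden k))
  have hle : ∀ k, blockSum p (k + 1) - 1 ≤ 2 * pathWeight p k / p ^ 2 := fun k => by
    rw [heq]
    exact div_le_div₀ (mul_nonneg two_pos.le (hP _)) (hnum k) hc (hden k)
  have hB : ∀ k, blockSum p (k + 1) ≤ 2 / p ^ 2 + 1 := fun k => by
    have : 2 * pathWeight p k / (p : ℝ) ^ 2 ≤ 2 / p ^ 2 :=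
      div_le_div_of_nonneg_right (by linarith [hP1 k]) hc.le
    linarith [hle k]
  refine Summable.of_nonneg_of_le (fun k => ?_) (fun k => ?_)
    ((summable_pathWeight h0 h1).mul_left ((2 / (p : ℝ) ^ 2 + 1) * (2 / p ^ 2)))
  · rw [secondMomentTerm_eq p hp0]
    exact mul_nonneg (by linarith [hnn (k + 1)]) (hnn k)
  · rw [secondMomentTerm_eq p hp0]
    calc blockSum p (k + 2) * (blockSum p (k + 1) - 1)
        ≤ (2 / (p : ℝ) ^ 2 + 1) * (2 * pathWeight p k / p ^ 2) :=
          mul_le_mul (hB (k + 1)) (hle k) (hnn k) (by positivity)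
      _ = _ := by ring

/-- Division with remainder, `n + 1 = (q + 1) d + r` with `d = r + s + 1`, parametrizes the pairs
`(n, d)` with `1 ≤ d ≤ n + 1` by triples `(q, r, s)`. -/
lemma hasSum_sum_jointMissing (p : unitInterval) (hp0 : 0 < p) :
    HasSum (fun n => ∑ i ∈ range (n + 1), jointMissing p n (i + 1))
      (∑' l : ℕ, secondMomentTerm p (l + 1)) := by
  have h0 : (0 : ℝ) < p := hp0
  have h1 : (p : ℝ) ≤ 1 := p.2.2
  let F : ℕ × ℕ × ℕ → ℝ := fun x =>
    blockWeight p (x.1 + 2) x.2.1 * blockWeight p (x.1 + 1) (x.2.2 + 1)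
  have hnn : ∀ k t, 0 ≤ blockWeight p k t := blockWeight_nonneg h0.le h1
  have hF0 : 0 ≤ F := fun x => mul_nonneg (hnn _ _) (hnn _ _)
  have hfib : ∀ q, HasSum (fun y => F (q, y)) (secondMomentTerm p (q + 1)) := by
    intro q
    rw [secondMomentTerm_eq p hp0]
    have a : HasSum (blockWeight p (q + 2)) (blockSum p (q + 2)) :=
      hasSum_blockWeight h0 h1 (q + 1)
    have b := hasSum_blockWeight_succ h0 h1 q
    have a0 : 0 ≤ blockWeight p (q + 2) := fun t => hnn _ t
    have b0 : 0 ≤ fun t => blockWeight p (q + 1) (t + 1) := fun t => hnn _ _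
    have hab := a.summable.mul_of_nonneg b.summable a0 b0
    have hm := HasSum.mul a b hab
    exact hm
  have hFsum : Summable F := by
    refine (summable_prod_of_nonneg hF0).2 ⟨fun q => (hfib q).summable, ?_⟩
    simpa only [(hfib _).tsum_eq] using summable_secondMomentTerm p hp0
  have hF : HasSum F (∑' l : ℕ, secondMomentTerm p (l + 1)) := by
    have := hFsum.hasSum.prod_fiberwise hfib
    rw [this.tsum_eq]
    exact hFsum.hasSum
  let φ : ℕ × ℕ × ℕ → ℕ × ℕ := fun x =>
    ((x.1 + 1) * (x.2.1 + x.2.2 + 1) + x.2.1 - 1, x.2.1 + x.2.2)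
  let h : ℕ × ℕ → ℝ := fun x => if x.2 < x.1 + 1 then jointMissing p x.1 (x.2 + 1) else 0
  have hpos : ∀ q r s : ℕ, r + s + 1 ≤ (q + 1) * (r + s + 1) := fun q r s =>
    Nat.le_mul_of_pos_left _ (by omega)
  have hφ : Function.Injective φ := by
    rintro ⟨q, r, s⟩ ⟨q', r', s'⟩ he
    simp only [φ, Prod.mk.injEq] at he
    obtain ⟨he1, he2⟩ := he
    have p1 := hpos q r s
    have p2 := hpos q' r' s'
    rw [← he2] at he1 p2
    have he3 : r + (r + s + 1) * (q + 1) = r' + (r + s + 1) * (q' + 1) := by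
      rw [mul_comm _ (q + 1), mul_comm _ (q' + 1)]
      omega
    have m1 := congrArg (· % (r + s + 1)) he3
    have m2 := congrArg (· / (r + s + 1)) he3
    have l1 : r < r + s + 1 := by omega
    have l2 : r' < r + s + 1 := by omega
    simp only [Nat.add_mul_mod_self_left, Nat.mod_eq_of_lt l1, Nat.mod_eq_of_lt l2] at m1
    simp only [Nat.add_mul_div_left _ _ (Nat.succ_pos (r + s)), Nat.div_eq_of_lt l1,
      Nat.div_eq_of_lt l2] at m2
    simp only [Prod.mk.injEq]
    omega
  have hrange : ∀ x, x ∉ Set.range φ → h x = 0 := by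
    rintro ⟨n, i⟩ hx
    refine if_neg fun hi => hx ?_
    simp only at hi
    have hdm := Nat.div_add_mod (n + 1) (i + 1)
    have hmod : (n + 1) % (i + 1) < i + 1 := Nat.mod_lt _ (Nat.succ_pos i)
    have hdiv : 1 ≤ (n + 1) / (i + 1) := (Nat.one_le_div_iff (by omega)).2 (by omega)
    refine ⟨((n + 1) / (i + 1) - 1, (n + 1) % (i + 1), i - (n + 1) % (i + 1)), ?_⟩
    simp only [φ]
    rw [Nat.sub_add_cancel hdiv, show (n + 1) % (i + 1) + (i - (n + 1) % (i + 1)) = i by omega,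
      mul_comm, hdm]
    simp
  have hcomp : h ∘ φ = F := by
    funext ⟨q, r, s⟩
    have := hpos q r s
    simp only [Function.comp, h, φ, F]
    rw [if_pos (by omega), jointMissing_eq]
  have hh : HasSum h (∑' l : ℕ, secondMomentTerm p (l + 1)) :=
    (hφ.hasSum_iff hrange).1 (hcomp ▸ hF)
  refine hh.prod_fiberwise fun n => ?_
  have : ∑ i ∈ range (n + 1), jointMissing p n (i + 1) = ∑ i ∈ range (n + 1), h (n, i) :=
    sum_congr rfl fun i hi => (if_pos (mem_range.1 hi)).symm
  rw [this]
  exact hasSum_sum_of_ne_finset_zero fun i hi => if_neg fun hi' => hi (mem_range.2 hi')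

/-- The distance `d = n + 1` corresponds to `q = 0`, `r = 0`: the sum of the probabilities of
`n ∉ A + A`, that is, the limit of the first moment of `Y`. -/
lemma hasSum_jointMissing_succ (p : unitInterval) (hp0 : 0 < p) :
    HasSum (fun n => jointMissing p n (n + 1)) (2 / (p : ℝ) ^ 2 - 1 / p - 1) := by
  have h0 : (0 : ℝ) < p := hp0
  rw [← blockSum_one_sub_one h0.ne']
  have := hasSum_blockWeight_succ h0 p.2.2 0
  convert this using 2 with n
  have h := jointMissing_eq p 0 0 n
  simpa [blockWeight_zero] using h

end Summation

end RandomSumset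

theorem mainTheorem6 (p : unitInterval) (hp0 : 0 < p) (hp1 : p < 1) :
    (∀ N : ℕ, MeasureTheory.Integrable
      (fun A : Set ℕ => (RandomSumset.missingSummands N A : ℝ) ^ 2)
      (RandomSumset.subsetLaw N p)) ∧
    Summable (fun l : ℕ => RandomSumset.secondMomentTerm p (l + 1)) ∧
    Filter.Tendsto
      (fun N : ℕ => ∫ A : Set ℕ, (RandomSumset.missingSummands N A : ℝ) ^ 2
        ∂(RandomSumset.subsetLaw N p))
      Filter.atTop
      (nhds (-(2 / (p : ℝ) ^ 2 - 1 / (p : ℝ) - 1)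
        + 2 * ∑' l : ℕ, RandomSumset.secondMomentTerm p (l + 1))) := by
  refine ⟨RandomSumset.integrable_missingSummands_sq p,
    RandomSumset.summable_secondMomentTerm p hp0, ?_⟩
  have h := ((RandomSumset.hasSum_sum_jointMissing p hp0).mul_left 2).sub
    (RandomSumset.hasSum_jointMissing_succ p hp0)
  rw [neg_add_eq_sub]
  simp only [RandomSumset.integral_missingSummands_sq]
  exact h.tendsto_sum_nat.comp (Filter.tendsto_add_atTop_nat 1)
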